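/- **The tree-like type theorem.** Let $T$ be a complete first order theory in a language $L$, and put $|T| = |L| + \aleph_0$. Assume that $T$ is dependent, that is, there are no $L$-formula $\varphi(\bar x,\bar y)$ (with $\bar x, \bar y$ finite), model $M$ of $T$ and tuples $\bar a_s$ ($s \subseteq \omega$), $\bar b_i$ ($i < \omega$) of $M$ such that $M \models \varphi[\bar a_s, \bar b_i] \Leftrightarrow i \in s$ for all $s$ and $i$. Let $\kappa$ be a regular cardinal, $\alpha$ an ordinal, $\theta = |T| + |\alpha| < \kappa$, and let $N$ be a $\kappa$-saturated model of $T$. Let $\mathbf S^{\alpha}(N)$ be the set of complete types over $N$ in the variables $\bar x = \langle x_i : i < \alpha\rangle$. For $n < \omega$ a type $r \in \mathbf S^{n}(N)$ *does not split* over $B \subseteq N$ if, whenever $\varphi(\bar x,\bar b), \neg\varphi(\bar x,\bar c) \in r$, we have $\mathrm{tp}(\bar b, B, N) \neq \mathrm{tp}(\bar c, B, N)$. Types $p(\bar x), r(\bar y)$ over $N$ are *weakly orthogonal* if $\mathrm{tp}(\bar a_1{}^\frown \bar b_1, N) = \mathrm{tp}(\bar a_2{}^\frown \bar b_2, N)$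 whenever $\bar a_1, \bar a_2$ realize $p$ and $\bar b_1, \bar b_2$ realize $r$ in an elementary extension of $N$. Let $q(\bar x) \in \mathbf S^{\alpha}(N)$ be weakly orthogonal to every $r \in \bigcup_{n<\omega}\mathbf S^{n}(N)$ that does not split over some $B \subseteq N$ with $|B| < \kappa$. Let $\bar z = \langle z_i : i < \theta\rangle$. Then there is a sequence $\langle \psi_{\varphi(\bar x,\bar y)}(\bar x, \bar z) : \varphi(\bar x,\bar y) \in \mathbb L(L),\ \bar y \text{ finite}\rangle$ of $L$-formulas such that for every $A \subseteq N$ with $|A| < \kappa$ there is $\bar c \in {}^{\theta}N$ with $$\{\psi_{\varphi(\bar x,\bar y)}(\bar x,\bar c) : \varphi(\bar x,\bar y) \in \mathbb L(L)\} \subseteq q \restriction \mathrm{Rang}(\bar c) \subseteq q,$$ and such that for each $\varphi(\bar x,\bar y)$, modulo the elementary diagram of $N$, $$\psi_{\varphi(\bar x,\bar y)}(\bar x,\bar c) \vdash \{\varphi(\bar x,\bar b) : \bar b \in {}^{\ell g(\bar y)}A \text{ and } \varphi(\bar x,\bar b) \in q\}.$$ -/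

import Mathlib

open FirstOrder Cardinal

universe u

namespace FirstOrder.Language

noncomputable section

/-- The cardinal `|T|` attached to a first order theory in the language `L`, following the usual
convention: `|T| = |L| + ℵ₀`, the number of first order formulas of the language. -/
def theoryCard (L : Language.{u, u}) : Cardinal.{u} := max ℵ₀ L.card

/-- `T` is independent if some formula `φ(x̄, ȳ)` (with finite `x̄`, `ȳ`) has, in some model `M` of
`T`, tuples `a_s` (`s ⊆ ω`) and `b_i` (`i < ω`) with `M ⊨ φ(a_s, b_i)` iff `i ∈ s`;
`T` is dependent if it is not independent. -/
def Theory.IsDependent {L : Language.{u, u}} (T : L.Theory) : Prop :=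
  ¬ ∃ (m n : ℕ) (φ : L.Formula (Fin m ⊕ Fin n)) (M : Theory.ModelType.{u, u, u} T)
      (a : Set ℕ → Fin m → M) (b : ℕ → Fin n → M),
    ∀ (s : Set ℕ) (i : ℕ), i ∈ s ↔ φ.Realize (Sum.elim (a s) (b i))

/-- Two complete types `p(x̄)`, `q(ȳ)` over the same set of parameters (that is, complete types of
the complete theory `T` of a structure with names for the parameters) are weakly orthogonal if
`tp(ā₁ ^ b̄₁) = tp(ā₂ ^ b̄₂)` whenever `ā₁`, `ā₂` realize `p` and `b̄₁`, `b̄₂` realize `q`. -/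
def Theory.CompleteType.WeaklyOrthogonal {L : Language.{u, u}} {T : L.Theory}
    {α : Type u} {β : Type} (p : T.CompleteType α) (q : T.CompleteType β) : Prop :=
  ∀ (M : Theory.ModelType.{u, u, u} T) (a₁ a₂ : α → M) (b₁ b₂ : β → M),
    T.typeOf a₁ = p → T.typeOf a₂ = p → T.typeOf b₁ = q → T.typeOf b₂ = q →
      T.typeOf (Sum.elim a₁ b₁) = T.typeOf (Sum.elim a₂ b₂)

section OverModel

variable (L : Language.{u, u}) (N : Type u) [L.Structure N] [Nonempty N]

/-- The type `tp(b̄, B, N)` of a tuple of `N` over a set `B ⊆ N`. -/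
def tp {β : Type*} (b : β → N) (B : Set N) : (L[[B]].completeTheory N).CompleteType β :=
  (L[[B]].completeTheory N).typeOf b

/-- `N` is `κ`-saturated: every complete `1`-type over a subset of `N` of cardinality less than `κ`
is realized in `N`. -/
def IsSaturated (κ : Cardinal.{u}) : Prop :=
  ∀ A : Set N, #A < κ → ∀ p : (L[[A]].completeTheory N).CompleteType (Fin 1),
    ∃ a : N, L.tp N (fun _ => a) A = p

/-- The complete types over all of `N` in variables indexed by `α`. A model of the elementary
diagram is the same as an elementary extension of `N`. -/
abbrev TypesOver (α : Type*) : Type _ := (L.elementaryDiagram N).CompleteType α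

variable {L N}

/-- The formula `φ(x̄, b̄)` with parameters from `N` which is obtained from `φ(x̄, ȳ)` by substituting
(names of) the elements `b̄` of `N` for the variables `ȳ`. -/
def inst {α β : Type*} (φ : L.Formula (α ⊕ β)) (b : β → N) : L[[N]].Formula α :=
  ((L.lhomWithConstants N).onFormula φ).subst
    (Sum.elim (fun x => Term.var x) (fun y => (L.con (b y)).term))

/-- The set of formulas `χ(x̄)` with parameters from `N` which belong to the type `q(x̄)`. -/
def formulasOf {α : Type*} (q : L.TypesOver N α) : Set (L[[N]].Formula α) :=
  {χ | Formula.equivSentence χ ∈ q}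

/-- The restriction of `q` to `B`: all `φ(x̄, b̄) ∈ q` with `b̄` a sequence from `B`. -/
def restrictTo {α : Type*} (q : L.TypesOver N α) (B : Set N) : Set (L[[N]].Formula α) :=
  {χ | ∃ (β : Type u) (φ : L.Formula (α ⊕ β)) (b : β → N),
    (∀ i, b i ∈ B) ∧ χ = inst φ b ∧ χ ∈ formulasOf q}

/-- `r` does not split over `B`: if `φ(x̄, b̄), ¬φ(x̄, c̄) ∈ r` then `tp(b̄, B) ≠ tp(c̄, B)`. -/
def NotSplitOver {α : Type*} (r : L.TypesOver N α) (B : Set N) : Prop :=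
  ∀ (n : ℕ) (φ : L.Formula (α ⊕ Fin n)) (b c : Fin n → N),
    inst φ b ∈ formulasOf r → (inst φ c).not ∈ formulasOf r → L.tp N b B ≠ L.tp N c B

/-- The finitary complete types over `N` (in `n` variables) which do not split over some subset of
`N` of cardinality less than `κ`. -/
def nspLT (N : Type u) [L.Structure N] [Nonempty N] (κ : Cardinal.{u}) (n : ℕ) :
    Set (L.TypesOver N (Fin n)) :=
  {r | ∃ B : Set N, #B < κ ∧ NotSplitOver r B}

/-- The complete types over `N` in variables indexed by `α` which are weakly orthogonal to every
finitary complete type over `N` not splitting over some subset of cardinality less than `κ`. -/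
def nspGE (N : Type u) [L.Structure N] [Nonempty N] (κ : Cardinal.{u}) (α : Type u) :
    Set (L.TypesOver N α) :=
  {q | ∀ (n : ℕ), ∀ r ∈ nspLT (L := L) N κ n, q.WeaklyOrthogonal r}

end OverModel

end

end FirstOrder.Language

namespace FirstOrder.Language

/-! ### Elementarity between `N` and its elementary extensions. -/

section Transfer

/-! Fix `φ` and a small `A`. If no single formula of `q` decided `φ(x̄, b̄)` for all `b̄` from `A`,
every finite part of `q` would have two realizations in `N` separated by `φ(x̄, b̄)` for some `b̄`
from `A`. In an ultrapower over the finite parts these become two realizations of `q` and a tuple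
whose type is finitely satisfiable in `A`, hence does not split over `A`; `φ` separates them,
against weak orthogonality (`exists_mem_formulasOf_decides`). A deciding formula of `q` implies
every instance of `φ` over `A` in `q`. It is an instance of some parameter-free `ψ`, and there are
at most `θ < κ` candidates. If each failed at some small set, the union of these sets, small by
regularity, would defeat all; so one `ψ` serves every `A`. The parameters for all `φ` then fit into
one `θ`-sequence. -/

theorem exists_realize_iff_realize_exClosure {L : Language.{u, u}} {α M : Type*} [DecidableEq α]
    [L.Structure M] [Nonempty M] (χ : L.Formula α) :
    (∃ v : α → M, χ.Realize v) ↔ M ⊨ χ.exClosure := by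
  rw [← Formula.exists_realize_equivSentence_iff_realize_exClosure]
  refine exists_congr fun v => ?_
  let := constantsOn.structure v
  exact (Formula.realize_equivSentence M χ).symm

/-- A formula is satisfiable in a structure iff it is in any model of its complete theory. -/
theorem exists_realize_iff_of_completeTheory {L : Language.{u, u}} {α M N : Type*}
    [L.Structure M] [L.Structure N] [Nonempty M] [Nonempty N] [M ⊨ L.completeTheory N]
    (χ : L.Formula α) :
    (∃ v : α → M, χ.Realize v) ↔ ∃ v : α → N, χ.Realize v := by
  classical
  rw [exists_realize_iff_realize_exClosure, exists_realize_iff_realize_exClosure]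
  exact realize_iff_of_model_completeTheory N M _

variable {L : Language.{u, u}} {N : Type u} [L.Structure N] {α : Type u}

/-- Every type over `N` is the type of a tuple in some model of the elementary diagram. -/
theorem TypesOver.exists_realization (q : L.TypesOver N α) :
    ∃ (M : Theory.ModelType.{u, u, u} (L.elementaryDiagram N)) (a : α → M),
      (L.elementaryDiagram N).typeOf a = q := by
  obtain ⟨M, a, ha⟩ := Theory.exists_modelType_is_realized_in _ q
  exact ⟨M, a, ha⟩

theorem mem_formulasOf_typeOf {β : Type*} {M : Type*} [L[[N]].Structure M]
    [M ⊨ L.elementaryDiagram N] [Nonempty M] (a : β → M) (χ : L[[N]].Formula β) :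
    χ ∈ formulasOf ((L.elementaryDiagram N).typeOf a) ↔ χ.Realize a :=
  Theory.CompleteType.formula_mem_typeOf (T := L.elementaryDiagram N)

theorem realize_inst {β γ : Type*} (φ : L.Formula (β ⊕ γ)) (b : γ → N) (v : β → N) :
    (inst φ b).Realize v ↔ φ.Realize (Sum.elim v b) := by
  unfold inst Formula.Realize
  rw [BoundedFormula.realize_subst]
  refine (LHom.realize_onBoundedFormula (L.lhomWithConstants N) φ).trans ?_
  have : (fun x : β ⊕ γ => ((Sum.elim (fun x => Term.var x)
      (fun y => (L.con (b y)).term) x : L[[N]].Term β).realize v)) = Sum.elim v b := by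
    funext x
    cases x
    · rfl
    · exact Term.realize_constants
  rw [this]

theorem iInf_mem_formulasOf (q : L.TypesOver N α) {ι : Type*} [Finite ι]
    (f : ι → L[[N]].Formula α) (h : ∀ i, f i ∈ formulasOf q) :
    Formula.iInf f ∈ formulasOf q := by
  obtain ⟨M, a, rfl⟩ := q.exists_realization
  simp only [mem_formulasOf_typeOf] at h ⊢
  simpa using h

variable [Nonempty N]

/-- A formula with parameters which holds everywhere in `N` follows from the elementary diagram. -/
theorem elementaryDiagram_models_of_forall (χ : L[[N]].Formula α)
    (h : ∀ v : α → N, χ.Realize v) : L.elementaryDiagram N ⊨ᵇ χ := by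
  rw [Theory.models_formula_iff]
  intro M v
  by_contra hv
  have : ∃ v : α → M, χ.not.Realize v := ⟨v, by simpa using hv⟩
  rw [exists_realize_iff_of_completeTheory (N := N)] at this
  obtain ⟨w, hw⟩ := this
  exact (Formula.realize_not.1 hw) (h w)

theorem formulasOf_mono (q : L.TypesOver N α) {χ χ' : L[[N]].Formula α}
    (h : ∀ v : α → N, χ.Realize v → χ'.Realize v) (hχ : χ ∈ formulasOf q) :
    χ' ∈ formulasOf q := by
  obtain ⟨M, a, rfl⟩ := q.exists_realization
  rw [mem_formulasOf_typeOf] at hχ ⊢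
  have := elementaryDiagram_models_of_forall (χ.imp χ') (by simpa using h)
  have := this.realize_formula M (v := a)
  exact Formula.realize_imp.1 this hχ

/-- The tuple `x̄` may be infinite, but only finitely many variables occur, so satisfiability is a
single sentence and descends to `N`. -/
theorem exists_realize_of_mem_formulasOf (q : L.TypesOver N α) {χ χ' : L[[N]].Formula α}
    (hχ : χ ∈ formulasOf q) (hχ' : χ' ∈ formulasOf q) :
    ∃ v : α → N, χ.Realize v ∧ χ'.Realize v := by
  obtain ⟨M, a, rfl⟩ := q.exists_realization
  rw [mem_formulasOf_typeOf] at hχ hχ'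
  have : ∃ v : α → M, (χ ⊓ χ').Realize v := ⟨a, Formula.realize_inf.2 ⟨hχ, hχ'⟩⟩
  rw [exists_realize_iff_of_completeTheory (N := N)] at this
  simpa using this

/-- Every formula with parameters is equivalent to an instance of a parameter-free formula in
countably many parameter variables. -/
theorem exists_formula_nat_realize_iff (χ : L[[N]].Formula α) :
    ∃ (ψ : L.Formula (α ⊕ ℕ)) (c : ℕ → N), ∀ v : α → N,
      ψ.Realize (Sum.elim v c) ↔ χ.Realize v := by
  classical
  let χ' : L.Formula (N ⊕ α) := BoundedFormula.constantsVarsEquiv χ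
  obtain ⟨g, hg⟩ := exists_injective_nat χ'.freeVarFinset
  let f : χ'.freeVarFinset → α ⊕ ℕ := fun x =>
    Sum.elim (fun _ => Sum.inr (g x)) (fun y => Sum.inl y) x.1
  -- Slot `g m` holds the parameter `m`; the other slots do not matter.
  let c : ℕ → N := fun k => if h : ∃ (m : N) (hm : Sum.inl m ∈ χ'.freeVarFinset),
    g ⟨Sum.inl m, hm⟩ = k then h.choose else Classical.arbitrary N
  refine ⟨χ'.restrictFreeVar f, c, fun v => ?_⟩
  have h1 : (χ'.restrictFreeVar f).Realize (Sum.elim v c) default ↔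
      χ'.Realize (Sum.elim id v) := by
    refine BoundedFormula.realize_restrictFreeVar _ ?_
    rintro ⟨m | y, hm⟩
    · have h : ∃ (m' : N) (hm' : Sum.inl m' ∈ χ'.freeVarFinset),
          g ⟨Sum.inl m', hm'⟩ = g ⟨Sum.inl m, hm⟩ := ⟨m, hm, rfl⟩
      obtain ⟨hm', he⟩ := h.choose_spec
      have := hg he
      simp only [Subtype.mk.injEq, Sum.inl.injEq] at this
      simp only [f, c, Sum.elim_inl, Sum.elim_inr, id]
      rw [dif_pos h, this]
    · simp [f]
  refine h1.trans ?_
  have := BoundedFormula.realize_constantsVarsEquiv (L := L) (φ := χ) (v := v)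
    (xs := (default : Fin 0 → N))
  exact this

end Transfer

/-! ### From weak orthogonality to local isolation. -/

section WeakOrthogonality

variable {L : Language.{u, u}} {N : Type u} [L.Structure N] [Nonempty N] {α : Type u}

/-- Tuples with the same type over `A` satisfy the same formulas with parameters from `A`. -/
theorem realize_iff_of_tp_eq {β γ : Type*} {A : Set N} {b c : β → N}
    (h : L.tp N b A = L.tp N c A) (φ : L.Formula (γ ⊕ β)) (a : γ → N) (ha : ∀ i, a i ∈ A) :
    φ.Realize (Sum.elim a b) ↔ φ.Realize (Sum.elim a c) := by
  let χ : L[[A]].Formula β := ((L.lhomWithConstants A).onFormula φ).subst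
    (Sum.elim (fun x => (L.con (⟨a x, ha x⟩ : A)).term) (fun y => Term.var y))
  have key : ∀ d : β → N, χ.Realize d ↔ φ.Realize (Sum.elim a d) := by
    intro d
    simp only [χ, Formula.Realize]
    rw [BoundedFormula.realize_subst]
    refine (LHom.realize_onBoundedFormula (L.lhomWithConstants A) φ).trans ?_
    have : (fun x : γ ⊕ β => ((Sum.elim (fun x => (L.con (⟨a x, ha x⟩ : A)).term)
        (fun y => Term.var y) x : L[[A]].Term β).realize d)) = Sum.elim a d := by
      funext x
      cases x <;> simp
    rw [this]
  rw [← key, ← key]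
  have hb := Theory.CompleteType.formula_mem_typeOf (T := L[[A]].completeTheory N) (v := b) (φ := χ)
  have hc := Theory.CompleteType.formula_mem_typeOf (T := L[[A]].completeTheory N) (v := c) (φ := χ)
  unfold tp at h
  rw [← hb, ← hc, h]

/-- A type over `N` all of whose formulas are realized by tuples from `A` does not split
over `A`. -/
theorem notSplitOver_of_finitelySatisfiable {β : Type*} {A : Set N} (r : L.TypesOver N β)
    (h : ∀ χ ∈ formulasOf r, ∀ χ' ∈ formulasOf r,
      ∃ a : β → N, (∀ i, a i ∈ A) ∧ χ.Realize a ∧ χ'.Realize a) :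
    NotSplitOver r A := by
  intro n φ b c hb hc heq
  obtain ⟨a, haA, h1, h2⟩ := h _ hb _ hc
  rw [realize_inst] at h1
  rw [Formula.realize_not, realize_inst] at h2
  exact h2 ((realize_iff_of_tp_eq heq φ a haA).1 h1)

/-- If `q` is weakly orthogonal to the types which do not split over small sets, then for small `A`
a single formula of `q` decides `φ(x̄, b̄)` for all `b̄` from `A`. -/
theorem exists_mem_formulasOf_decides {κ : Cardinal.{u}} (q : L.TypesOver N α)
    (hq : q ∈ nspGE (L := L) N κ α) {A : Set N} (hA : #A < κ) {n : ℕ}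
    (φ : L.Formula (α ⊕ Fin n)) :
    ∃ χ ∈ formulasOf q, ∀ b : Fin n → N, (∀ i, b i ∈ A) → ∀ a₁ a₂ : α → N,
      χ.Realize a₁ → χ.Realize a₂ → φ.Realize (Sum.elim a₁ b) → φ.Realize (Sum.elim a₂ b) := by
  by_contra hcon
  push Not at hcon
  let I := Finset (formulasOf q)
  let conj : I → L[[N]].Formula α := fun s => Formula.iInf fun χ : s => (χ : formulasOf q).1
  have hconj : ∀ s, conj s ∈ formulasOf q := fun s =>
    iInf_mem_formulasOf q _ fun χ => (χ : formulasOf q).2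
  choose b hbA a₁ a₂ h₁ h₂ hφ₁ hφ₂ using fun s : I => hcon (conj s) (hconj s)
  classical
  -- Refining `atTop` makes each formula of `q` a conjunct of `conj s` for almost all `s`.
  let U : Ultrafilter I := Ultrafilter.of Filter.atTop
  let M := (U : Filter I).Product fun _ => N
  let : L[[N]].Structure M := Ultraproduct.structure (u := U) (M := fun _ => N)
  have hModel : M ⊨ L.elementaryDiagram N := by
    exact ⟨fun σ hσ => (Ultraproduct.sentence_realize (u := U) (M := fun _ => N) σ).2
      (Filter.Eventually.of_forall fun _ => hσ)⟩
  let mk : (I → α → N) → α → M := fun x i => ((fun s => x s i : I → N) : M)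
  let tup : (I → Fin n → N) → Fin n → M := fun x i => ((fun s => x s i : I → N) : M)
  have los : ∀ (x : I → α → N) (χ : L[[N]].Formula α), χ.Realize (mk x) ↔
      ∀ᶠ s in (U : Filter I), χ.Realize (x s) := fun x χ =>
    Ultraproduct.realize_formula_cast (u := U) (M := fun _ => N) χ fun i s => x s i
  have los' : ∀ (x : I → Fin n → N) (χ : L[[N]].Formula (Fin n)), χ.Realize (tup x) ↔
      ∀ᶠ s in (U : Filter I), χ.Realize (x s) := fun x χ =>
    Ultraproduct.realize_formula_cast (u := U) (M := fun _ => N) χ fun i s => x s i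
  have htype : ∀ x : I → α → N, (∀ s, (conj s).Realize (x s)) →
      (L.elementaryDiagram N).typeOf (mk x) = q := by
    intro x hx
    have hsub : ∀ χ ∈ formulasOf q, χ.Realize (mk x) := by
      intro χ hχ
      rw [los]
      have : ∀ᶠ s in (Filter.atTop : Filter I), χ.Realize (x s) := by
        filter_upwards [Filter.eventually_ge_atTop ({⟨χ, hχ⟩} : I)] with s hs
        have := hx s
        simp only [conj, Formula.realize_iInf] at this
        exact this ⟨⟨χ, hχ⟩, Finset.singleton_subset_iff.1 hs⟩
      exact Ultrafilter.of_le _ this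
    refine SetLike.ext fun σ => ?_
    obtain ⟨χ, rfl⟩ := Formula.equivSentence.surjective σ
    rw [Theory.CompleteType.formula_mem_typeOf]
    refine ⟨fun h => ?_, fun h => hsub χ h⟩
    -- Completeness of `q` turns the inclusion `hsub` into equality of types.
    by_contra hn
    rw [← Theory.CompleteType.not_mem_iff] at hn
    exact Formula.realize_not.1 (hsub χ.not hn) h
  have hr : (L.elementaryDiagram N).typeOf (tup b) ∈ nspLT (L := L) N κ n := by
    refine ⟨A, hA, notSplitOver_of_finitelySatisfiable _ fun χ hχ χ' hχ' => ?_⟩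
    rw [mem_formulasOf_typeOf, los'] at hχ hχ'
    obtain ⟨s, hs, hs'⟩ := (hχ.and hχ').exists
    exact ⟨b s, hbA s, hs, hs'⟩
  have hwo := hq n _ hr (Theory.ModelType.of _ M) (mk a₁) (mk a₂) (tup b) (tup b)
    (htype a₁ h₁) (htype a₂ h₂) rfl rfl
  let φ' : L[[N]].Formula (α ⊕ Fin n) := (L.lhomWithConstants N).onFormula φ
  have losφ : ∀ x : I → α → N, φ'.Realize (Sum.elim (mk x) (tup b)) ↔
      ∀ᶠ s in (U : Filter I), φ.Realize (Sum.elim (x s) (b s)) := by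
    intro x
    have := Ultraproduct.realize_formula_cast (u := U) (M := fun _ => N) φ'
      (Sum.elim (fun i s => x s i) fun i s => b s i)
    have e1 : (fun i => ((Sum.elim (fun i s => x s i) (fun i s => b s i) i : I → N) : M)) =
        Sum.elim (mk x) (tup b) := by
      funext i; cases i <;> rfl
    have e2 : ∀ s, (fun i => Sum.elim (fun i s => x s i) (fun i s => b s i) i s) =
        Sum.elim (x s) (b s) := by
      intro s; funext i; cases i <;> rfl
    rw [e1] at this
    simp only [e2] at this
    refine this.trans (Filter.eventually_congr (Filter.Eventually.of_forall fun s => ?_))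
    exact LHom.realize_onFormula _ _
  have hin : Formula.equivSentence φ' ∈
      (L.elementaryDiagram N).typeOf (Sum.elim (mk a₁) (tup b)) := by
    rw [Theory.CompleteType.formula_mem_typeOf, losφ]
    exact Filter.Eventually.of_forall hφ₁
  have hin₂ : Formula.equivSentence φ' ∈
      (L.elementaryDiagram N).typeOf (Sum.elim (mk a₂) (tup b)) := hwo ▸ hin
  rw [Theory.CompleteType.formula_mem_typeOf, losφ] at hin₂
  obtain ⟨s, hs⟩ := hin₂.exists
  exact hφ₂ s hs

/-- Local isolation: over a small `A`, the instances of `φ` in `q` follow from one instance in `q`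
of a formula without parameters. -/
theorem exists_formula_nat_isolates {κ : Cardinal.{u}} (q : L.TypesOver N α)
    (hq : q ∈ nspGE (L := L) N κ α) {A : Set N} (hA : #A < κ) {n : ℕ}
    (φ : L.Formula (α ⊕ Fin n)) :
    ∃ (ψ : L.Formula (α ⊕ ℕ)) (c : ℕ → N), inst ψ c ∈ formulasOf q ∧
      ∀ b : Fin n → N, (∀ i, b i ∈ A) → inst φ b ∈ formulasOf q →
        ∀ v : α → N, ψ.Realize (Sum.elim v c) → φ.Realize (Sum.elim v b) := by
  obtain ⟨χ, hχ, hdec⟩ := exists_mem_formulasOf_decides q hq hA φ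
  obtain ⟨ψ, c, hψ⟩ := exists_formula_nat_realize_iff χ
  refine ⟨ψ, c, formulasOf_mono q (fun v hv => ?_) hχ, fun b hb hφ v hv => ?_⟩
  · rwa [realize_inst, hψ]
  -- One witness of `χ` and `φ(x̄, b̄)` suffices: `χ` carries the truth value to all its
  -- realizations.
  · obtain ⟨w, hw, hw'⟩ := exists_realize_of_mem_formulasOf q hχ hφ
    exact hdec b hb w v hw ((hψ v).1 hv) ((realize_inst φ b w).1 hw')

end WeakOrthogonality

/-! ### Counting formulas and choosing one uniformly. -/

section Uniformity

variable {L : Language.{u, u}} {N : Type u} [L.Structure N] [Nonempty N]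

theorem mk_formula_le (L : Language.{u, u}) (α : Type u) (β : Type) [Countable β] :
    #(L.Formula (α ⊕ β)) ≤ L.theoryCard + #α := by
  have h0 : ℵ₀ ≤ L.theoryCard := le_max_left _ _
  have h1 : #(L.Formula (α ⊕ β)) ≤ #(Σ n, L.BoundedFormula (α ⊕ β) n) :=
    mk_le_of_injective (f := fun φ => (⟨0, φ⟩ : Σ n, L.BoundedFormula (α ⊕ β) n))
      fun _ _ h => by simpa using h
  refine h1.trans (BoundedFormula.card_le.trans ?_)
  have h2 : #(α ⊕ β) ≤ L.theoryCard + #α := by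
    rw [mk_sum, add_comm]
    have : Cardinal.lift.{u} #β ≤ ℵ₀ := by simp
    simpa using add_le_add (this.trans h0) le_rfl
  have h3 : L.card ≤ L.theoryCard + #α := (le_max_right _ _).trans (self_le_add_right _ _)
  have h4 : ℵ₀ ≤ L.theoryCard + #α := h0.trans (self_le_add_right _ _)
  simp only [lift_id]
  exact max_le h4 ((add_le_add h2 h3).trans (add_eq_self h4).le)

/-- A property of pairs `(A, i)` which is antitone in the set `A`, and which every small `A` has for
some `i`, holds for a single `i` for all small `A` when there are few indices `i`. -/
theorem exists_uniform_of_isRegular {κ : Cardinal.{u}} (hκ : κ.IsRegular) {ι N : Type u}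
    (hι : #ι < κ) (P : Set N → ι → Prop) (hP : ∀ A B i, A ⊆ B → P B i → P A i)
    (h : ∀ A : Set N, #A < κ → ∃ i, P A i) : ∃ i, ∀ A : Set N, #A < κ → P A i := by
  by_contra! hcon
  choose A hA hPA using hcon
  obtain ⟨i, hi⟩ := h (⋃ i, A i) ((card_iUnion_lt_iff_forall_of_isRegular hκ hι).2 hA)
  exact hPA i (hP _ _ i (Set.subset_iUnion A i) hi)

end Uniformity

end FirstOrder.Language

/-! ### Assembling the parameters. -/

open FirstOrder.Language in
theorem theorem1 {L : FirstOrder.Language.{u, u}} (T : L.Theory)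
    (hT : T.IsComplete) (hdep : T.IsDependent)
    (κ θ : Cardinal.{u}) (hκreg : κ.IsRegular) (α : Ordinal.{u})
    (hθ : θ = L.theoryCard + α.card) (hκ : θ < κ)
    (N : Type u) [L.Structure N] [Nonempty N] [N ⊨ T] (hN : L.IsSaturated N κ)
    (q : L.TypesOver N α.ToType)
    (hq : q ∈ FirstOrder.Language.nspGE (L := L) N κ α.ToType) :
    ∃ ψ : ∀ n : ℕ, L.Formula (α.ToType ⊕ Fin n) → L.Formula (α.ToType ⊕ θ.ord.ToType),
      ∀ A : Set N, #A < κ → ∃ c : θ.ord.ToType → N,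
        ({χ | ∃ (n : ℕ) (φ : L.Formula (α.ToType ⊕ Fin n)),
            χ = FirstOrder.Language.inst (ψ n φ) c} ⊆
          FirstOrder.Language.restrictTo q (Set.range c)) ∧
        (FirstOrder.Language.restrictTo q (Set.range c) ⊆
          FirstOrder.Language.formulasOf q) ∧
        ∀ (n : ℕ) (φ : L.Formula (α.ToType ⊕ Fin n)) (b : Fin n → N), (∀ i, b i ∈ A) →
          FirstOrder.Language.inst φ b ∈ FirstOrder.Language.formulasOf q →
            ((L.elementaryDiagram N) ⊨ᵇ
              (FirstOrder.Language.inst (ψ n φ) c).imp (FirstOrder.Language.inst φ b)) := by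
  have hcard : α.card = #α.ToType := (Cardinal.mk_toType α).symm
  have haleph : ℵ₀ ≤ θ := by
    rw [hθ]
    exact (le_max_left _ _).trans (self_le_add_right _ _)
  have hunif : ∀ p : Σ n, L.Formula (α.ToType ⊕ Fin n), ∃ ψ : L.Formula (α.ToType ⊕ ℕ),
      ∀ A : Set N, #A < κ → ∃ c : ℕ → N, inst ψ c ∈ formulasOf q ∧
        ∀ b : Fin p.1 → N, (∀ i, b i ∈ A) → inst p.2 b ∈ formulasOf q →
          ∀ v : α.ToType → N, ψ.Realize (Sum.elim v c) → p.2.Realize (Sum.elim v b) := by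
    rintro ⟨n, φ⟩
    refine exists_uniform_of_isRegular hκreg
      ((mk_formula_le L α.ToType ℕ).trans_lt (by rwa [← hcard, ← hθ])) _ ?_ ?_
    · rintro A B ψ hAB ⟨c, hc, h⟩
      exact ⟨c, hc, fun b hb => h b fun i => hAB (hb i)⟩
    · intro A hA
      exact exists_formula_nat_isolates q hq hA φ
  choose ψ hψ using hunif
  have hemb : Nonempty (((Σ n, L.Formula (α.ToType ⊕ Fin n)) × ℕ) ↪ θ.ord.ToType) := by
    rw [← Cardinal.le_def, mk_toType, card_ord, mk_prod, mk_sigma]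
    have h1 : Cardinal.sum (fun n => #(L.Formula (α.ToType ⊕ Fin n))) ≤ θ := by
      have h2 : ∀ n, #(L.Formula (α.ToType ⊕ Fin n)) ≤ θ := fun n =>
        (mk_formula_le L α.ToType (Fin n)).trans (by rw [← hcard, ← hθ])
      refine (Cardinal.sum_le_sum _ (fun _ => θ) h2).trans ?_
      simpa using (mul_le_mul' haleph le_rfl).trans (mul_eq_self haleph).le
    simpa using (mul_le_mul' h1 haleph).trans (mul_eq_self haleph).le
  obtain ⟨e⟩ := hemb
  -- Each `φ` gets its own block of coordinates of `z̄`, fixed before `A`; only the values in it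
  -- depend on `A`.
  refine ⟨fun n φ => (ψ ⟨n, φ⟩).relabel (Sum.map id fun k => e (⟨n, φ⟩, k)), fun A hA => ?_⟩
  choose c hc hiso using fun p => hψ p A hA
  let d : θ.ord.ToType → N :=
    Function.extend e (fun x => c x.1 x.2) fun _ => Classical.arbitrary N
  have hd : ∀ p k, d (e (p, k)) = c p k := fun p k => e.injective.extend_apply _ _ (p, k)
  have hreal : ∀ (n : ℕ) (φ : L.Formula (α.ToType ⊕ Fin n)) (v : α.ToType → N),
      (inst ((ψ ⟨n, φ⟩).relabel (Sum.map id fun k => e (⟨n, φ⟩, k))) d).Realize v ↔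
        (ψ ⟨n, φ⟩).Realize (Sum.elim v (c ⟨n, φ⟩)) := by
    intro n φ v
    rw [realize_inst, Formula.realize_relabel]
    have : Sum.elim v d ∘ Sum.map id (fun k => e (⟨n, φ⟩, k)) = Sum.elim v (c ⟨n, φ⟩) := by
      funext x
      cases x
      · rfl
      · exact hd _ _
    rw [this]
  refine ⟨d, ?_, ?_, ?_⟩
  · rintro χ ⟨n, φ, rfl⟩
    refine ⟨_, _, d, fun i => Set.mem_range_self i, rfl, ?_⟩
    refine formulasOf_mono q (fun v hv => ?_) (hc ⟨n, φ⟩)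
    rwa [hreal, ← realize_inst]
  · rintro χ ⟨_, _, _, _, _, h⟩
    exact h
  · intro n φ b hb hφ
    refine elementaryDiagram_models_of_forall _ fun v => ?_
    refine Formula.realize_imp.2 fun hv => ?_
    rw [realize_inst]
    exact hiso ⟨n, φ⟩ b hb hφ v ((hreal n φ v).1 hv)
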